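/- Let $k$ be a field and let $n\ge 1$. All manifolds are compact, smooth and oriented, and may be empty or disconnected; closed manifolds have no boundary. A cobordism $M:\Sigma_0\rightsquigarrow\Sigma_1$ between closed $(n-1)$-manifolds is an $n$-manifold $M$ with $\partial M=\partial_{\mathrm{in}}M\sqcup\partial_{\mathrm{out}}M$ and orientation-preserving diffeomorphisms $\Sigma_0\to\overline{\partial_{\mathrm{in}}M}$ and $\Sigma_1\to\partial_{\mathrm{out}}M$. Two cobordisms $\Sigma_0\rightsquigarrow\Sigma_1$ are equivalent if there is an orientation-preserving diffeomorphism between them that commutes with these boundary diffeomorphisms. An $n$-dimensional oriented TQFT over $k$ is a symmetric monoidal functor $\mathcal T$ from $n$-dimensional cobordisms to $k$-vector spaces: it assigns a vector space $\mathcal T(\Sigma)$ to each closed $(n-1)$-manifold $\Sigma$ and a linear map $\mathcal T(M):\mathcal T(\Sigma_0)\to\mathcal T(\Sigma_1)$ to each cobordism $M:\Sigma_0\rightsquigarrow\Sigma_1$, such that equivalent cobordisms have the same image, gluing goes to composition, cylinders go to identity maps, disjoint unions of $(n-1)$-manifolds and of cobordisms go to tensor products (compatibly with the associativity, unit and symmetry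 isomorphisms), and $\mathcal T(\emptyset)=k$. Consider the TQFTs with $\mathcal T(\Sigma)=k$ for all $\Sigma$, where the identification $\mathcal T(\Sigma)\otimes\mathcal T(\Sigma')=\mathcal T(\Sigma\sqcup\Sigma')$ is the multiplication $k\otimes k=k$. Two of them are regarded as equal if they assign the same linear map $k\to k$ to every cobordism (they are not identified when they are merely naturally isomorphic). They form a commutative monoid under the tensor product, $(\mathcal T\otimes\mathcal T')(M)=\mathcal T(M)\otimes\mathcal T'(M)$, whose unit is the trivial TQFT, which sends every cobordism to $\mathrm{id}_k$. Let $\mathbf{nTQFT}_k^\times$ be the group of invertible elements of this monoid, and let $\mathscr T^n_k\subseteq\mathbf{nTQFT}_k^\times$ be the subgroup of all $\mathcal T$ such that $\mathcal T(M)=\mathrm{id}_k$ for every $n$-dimensional cobordism $M$ with empty boundary. Theorem. The group $\mathscr T^n_k$ is trivial if and only if the group $k^\times$ is trivial. -/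

import Mathlib

open scoped Manifold ContDiff TensorProduct Topology

noncomputable section

/-! ### Orientations -/

section LinearAlgebra

variable {E E' : Type*} [AddCommGroup E] [Module ℝ E] [AddCommGroup E'] [Module ℝ E']

/-- The linear map `L` is an isomorphism that carries the orientation `o` to `o'`. -/
def PreservesOrientation {ι : Type*} (L : E →ₗ[ℝ] E')
    (o : Orientation ℝ E ι) (o' : Orientation ℝ E' ι) : Prop :=
  ∃ e : E ≃ₗ[ℝ] E', (e : E →ₗ[ℝ] E') = L ∧ Orientation.map ι e o = o'

/-- `L : E → E'` is the inclusion of a hyperplane, `v` is transverse to it, and the orientation `o`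
of `E` is the one for which `(v, L b₁, …, L b_d)` is positive for `o'` whenever `(b₁, …, b_d)` is
positive for `o`. Orientations are rays of volume forms, so that this says that `o` is the ray of
`η (v, L ·, …, L ·)` when `o'` is the ray of `η`; for `d = 0` the orientation `o` is a sign. -/
def InducesOrientation {d : ℕ} (L : E →ₗ[ℝ] E') (v : E')
    (o : Orientation ℝ E (Fin d)) (o' : Orientation ℝ E' (Fin (d + 1))) : Prop :=
  ∃ (η : E' [⋀^Fin (d + 1)]→ₗ[ℝ] ℝ) (hη : η ≠ 0) (hL : (η.curryLeft v).compLinearMap L ≠ 0),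
    o' = rayOfNeZero ℝ η hη ∧ o = rayOfNeZero ℝ ((η.curryLeft v).compLinearMap L) hL

end LinearAlgebra

section Manifold

variable {E : Type*} [NormedAddCommGroup E] [NormedSpace ℝ E] {H : Type*} [TopologicalSpace H]

/-- A choice of orientations of the tangent spaces is continuous if it is locally constant
in charts. -/
def IsContinuousOrientation {ι : Type*} (I : ModelWithCorners ℝ E H) {M : Type*}
    [TopologicalSpace M] [ChartedSpace H M] [IsManifold I ∞ M]
    (o : ∀ x : M, Orientation ℝ (TangentSpace I x) ι) : Prop :=
  ∀ x : M, ∀ᶠ y in 𝓝 x,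
    PreservesOrientation (tangentCoordChange I y x y : E →ₗ[ℝ] E) (o y) (o x)

variable {M N : Type*} [TopologicalSpace M] [ChartedSpace H M] [TopologicalSpace N]
  [ChartedSpace H N]

/-- An orientation of a disjoint union, from orientations of the two parts. -/
def sumOrientation {ι : Type*} (I : ModelWithCorners ℝ E H)
    (o : ∀ x : M, Orientation ℝ (TangentSpace I x) ι)
    (o' : ∀ x : N, Orientation ℝ (TangentSpace I x) ι) :
    ∀ x : M ⊕ N, Orientation ℝ (TangentSpace I x) ι
  | Sum.inl x => o x
  | Sum.inr x => o' x

end Manifold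

/-! ### Closed manifolds and cobordisms -/

/-- The half-space `ℝ^d × [0, ∞)`, on which `(d + 1)`-manifolds with boundary are modelled. -/
abbrev halfSpaceModel (d : ℕ) :
    ModelWithCorners ℝ (EuclideanSpace ℝ (Fin d) × EuclideanSpace ℝ (Fin 1))
      (ModelProd (EuclideanSpace ℝ (Fin d)) (EuclideanHalfSpace 1)) :=
  (𝓡 d).prod (𝓡∂ 1)

/-- A closed (compact, without boundary) smooth oriented `d`-manifold, possibly empty or
disconnected. -/
structure ClosedManifold (d : ℕ) where
  carrier : Type
  [top : TopologicalSpace carrier]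
  [t2 : T2Space carrier]
  [compact : CompactSpace carrier]
  [charted : ChartedSpace (EuclideanSpace ℝ (Fin d)) carrier]
  [smooth : IsManifold (𝓡 d) ∞ carrier]
  orientation : ∀ x : carrier, Orientation ℝ (TangentSpace (𝓡 d) x) (Fin d)
  orientation_cont : IsContinuousOrientation (𝓡 d) orientation

instance {d : ℕ} : CoeSort (ClosedManifold d) Type := ⟨ClosedManifold.carrier⟩

attribute [instance] ClosedManifold.top ClosedManifold.t2 ClosedManifold.compact
  ClosedManifold.charted ClosedManifold.smooth

/-- An oriented cobordism from `A` to `B`: a compact smooth oriented `(d + 1)`-manifold with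
boundary, together with embeddings of `A` and `B` whose images are disjoint and make up the boundary
(the in-boundary and the out-boundary). The embedding of `B` preserves orientations and that of `A`
reverses them, for the boundary orientation with the outward normal vector first; equivalently, one
uses an outward normal vector first along `B` and an inward one along `A`. A tangent vector at a
boundary point is inward (outward) if its last coordinate is positive (negative). The orientation
conditions make the derivatives of the two maps injective. -/
structure Cobordism {d : ℕ} (A B : ClosedManifold d) where
  carrier : Type
  [top : TopologicalSpace carrier]
  [t2 : T2Space carrier]
  [compact : CompactSpace carrier]
  [charted : ChartedSpace (ModelProd (EuclideanSpace ℝ (Fin d)) (EuclideanHalfSpace 1)) carrier]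
  [smooth : IsManifold (halfSpaceModel d) ∞ carrier]
  orientation : ∀ x : carrier, Orientation ℝ (TangentSpace (halfSpaceModel d) x) (Fin (d + 1))
  orientation_cont : IsContinuousOrientation (halfSpaceModel d) orientation
  inMap : A → carrier
  outMap : B → carrier
  inMap_smooth : ContMDiff (𝓡 d) (halfSpaceModel d) ∞ inMap
  outMap_smooth : ContMDiff (𝓡 d) (halfSpaceModel d) ∞ outMap
  inMap_injective : Function.Injective inMap
  outMap_injective : Function.Injective outMap
  disjoint_range : Disjoint (Set.range inMap) (Set.range outMap)
  range_union : Set.range inMap ∪ Set.range outMap = (halfSpaceModel d).boundary carrier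
  inMap_orientation : ∀ (a : A) (v : EuclideanSpace ℝ (Fin d) × EuclideanSpace ℝ (Fin 1)),
    0 < v.2 0 → InducesOrientation (mfderiv (𝓡 d) (halfSpaceModel d) inMap a).toLinearMap v
      (A.orientation a) (orientation (inMap a))
  outMap_orientation : ∀ (b : B) (v : EuclideanSpace ℝ (Fin d) × EuclideanSpace ℝ (Fin 1)),
    v.2 0 < 0 → InducesOrientation (mfderiv (𝓡 d) (halfSpaceModel d) outMap b).toLinearMap v
      (B.orientation b) (orientation (outMap b))

instance {d : ℕ} (A B : ClosedManifold d) : CoeSort (Cobordism A B) Type := ⟨Cobordism.carrier⟩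

attribute [instance] Cobordism.top Cobordism.t2 Cobordism.compact Cobordism.charted
  Cobordism.smooth

/-- The empty closed manifold. -/
def ClosedManifold.empty (d : ℕ) : ClosedManifold d :=
  letI : ChartedSpace (EuclideanSpace ℝ (Fin d)) Empty := ChartedSpace.empty _ _
  { carrier := Empty
    orientation := fun x => x.elim
    orientation_cont := fun x => x.elim }

section SumHelpers

variable {E : Type*} [NormedAddCommGroup E] [NormedSpace ℝ E] {H : Type*} [TopologicalSpace H]
  {M N : Type*} [TopologicalSpace M] [ChartedSpace H M] [TopologicalSpace N]
  [ChartedSpace H N] {I : ModelWithCorners ℝ E H}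

theorem extChartAt_sum_inl_symm (x : M) (p : E) :
    (extChartAt I (Sum.inl x : M ⊕ N)).symm p = Sum.inl ((extChartAt I x).symm p) := by
  simp [extChartAt, ChartedSpace.sum_chartAt_inl]

theorem extChartAt_sum_inr_symm (x : N) (p : E) :
    (extChartAt I (Sum.inr x : M ⊕ N)).symm p = Sum.inr ((extChartAt I x).symm p) := by
  simp [extChartAt, ChartedSpace.sum_chartAt_inr]

theorem tangentCoordChange_sum_inl [IsManifold I 1 M] [IsManifold I 1 N] (x y z : M) :
    tangentCoordChange I (Sum.inl y : M ⊕ N) (Sum.inl x) (Sum.inl z)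
      = tangentCoordChange I y x z := by
  rw [tangentCoordChange_def, tangentCoordChange_def, extChartAt_inl_apply]
  congr 1
  funext p
  simp only [Function.comp_apply, extChartAt_sum_inl_symm, extChartAt_inl_apply]

theorem tangentCoordChange_sum_inr [IsManifold I 1 M] [IsManifold I 1 N] (x y z : N) :
    tangentCoordChange I (Sum.inr y : M ⊕ N) (Sum.inr x) (Sum.inr z)
      = tangentCoordChange I y x z := by
  rw [tangentCoordChange_def, tangentCoordChange_def, extChartAt_inr_apply]
  congr 1
  funext p
  simp only [Function.comp_apply, extChartAt_sum_inr_symm, extChartAt_inr_apply]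

theorem IsContinuousOrientation.sum {ι : Type*} [IsManifold I ∞ M] [IsManifold I ∞ N]
    {o : ∀ x : M, Orientation ℝ (TangentSpace I x) ι}
    {o' : ∀ x : N, Orientation ℝ (TangentSpace I x) ι}
    (h : IsContinuousOrientation I o) (h' : IsContinuousOrientation I o') :
    IsContinuousOrientation I (sumOrientation I o o') := by
  rintro (x | x)
  · rw [(Topology.IsOpenEmbedding.inl (Y := N)).map_nhds_eq x |>.symm, Filter.eventually_map]
    filter_upwards [h x] with y hy
    rw [tangentCoordChange_sum_inl]
    exact hy
  · rw [(Topology.IsOpenEmbedding.inr (X := M)).map_nhds_eq x |>.symm, Filter.eventually_map]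
    filter_upwards [h' x] with y hy
    rw [tangentCoordChange_sum_inr]
    exact hy

variable {E' : Type*} [NormedAddCommGroup E'] [NormedSpace ℝ E'] {H' : Type*}
  [TopologicalSpace H'] {M' N' : Type*} [TopologicalSpace M'] [ChartedSpace H' M']
  [TopologicalSpace N'] [ChartedSpace H' N'] {J : ModelWithCorners ℝ E' H'}

theorem mfderiv_sumMap_inl {f : M → M'} {g : N → N'} (hf : ContMDiff I J ∞ f)
    (hg : ContMDiff I J ∞ g) (x : M) :
    (mfderiv I J (Sum.map f g) (Sum.inl x : M ⊕ N) : E →L[ℝ] E') = mfderiv I J f x := by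
  have h1 : MDifferentiableAt I J f x := (hf x).mdifferentiableAt (by simp)
  have h2 : MDifferentiableAt I J (Sum.map f g) (Sum.inl x : M ⊕ N) :=
    ((hf.sumMap hg) _).mdifferentiableAt (by simp)
  refine h2.mfderiv.trans (Eq.trans ?_ h1.mfderiv.symm)
  rw [extChartAt_inl_apply]
  congr 1
  funext p
  simp only [writtenInExtChartAt, Function.comp_apply, extChartAt_sum_inl_symm, Sum.map_inl,
    extChartAt_inl_apply]

theorem mfderiv_sumMap_inr {f : M → M'} {g : N → N'} (hf : ContMDiff I J ∞ f)
    (hg : ContMDiff I J ∞ g) (x : N) :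
    (mfderiv I J (Sum.map f g) (Sum.inr x : M ⊕ N) : E →L[ℝ] E') = mfderiv I J g x := by
  have h1 : MDifferentiableAt I J g x := (hg x).mdifferentiableAt (by simp)
  have h2 : MDifferentiableAt I J (Sum.map f g) (Sum.inr x : M ⊕ N) :=
    ((hf.sumMap hg) _).mdifferentiableAt (by simp)
  refine h2.mfderiv.trans (Eq.trans ?_ h1.mfderiv.symm)
  rw [extChartAt_inr_apply]
  congr 1
  funext p
  simp only [writtenInExtChartAt, Function.comp_apply, extChartAt_sum_inr_symm, Sum.map_inr,
    extChartAt_inr_apply]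

end SumHelpers

/-- The disjoint union of closed manifolds. -/
def ClosedManifold.sum {d : ℕ} (A B : ClosedManifold d) : ClosedManifold d where
  carrier := A ⊕ B
  orientation := sumOrientation (𝓡 d) A.orientation B.orientation
  orientation_cont := A.orientation_cont.sum B.orientation_cont

/-- The disjoint union of cobordisms. -/
def Cobordism.sum {d : ℕ} {A B A' B' : ClosedManifold d} (M : Cobordism A B)
    (N : Cobordism A' B') : Cobordism (A.sum A') (B.sum B') where
  carrier := M ⊕ N
  orientation := sumOrientation (halfSpaceModel d) M.orientation N.orientation
  orientation_cont := M.orientation_cont.sum N.orientation_cont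
  inMap := Sum.map M.inMap N.inMap
  outMap := Sum.map M.outMap N.outMap
  inMap_smooth := M.inMap_smooth.sumMap N.inMap_smooth
  outMap_smooth := M.outMap_smooth.sumMap N.outMap_smooth
  inMap_injective := M.inMap_injective.sumMap N.inMap_injective
  outMap_injective := M.outMap_injective.sumMap N.outMap_injective
  disjoint_range := by
    have hM := Set.disjoint_range_iff.1 M.disjoint_range
    have hN := Set.disjoint_range_iff.1 N.disjoint_range
    refine Set.disjoint_range_iff.2 ?_
    rintro (a | a) (b | b) h
    · exact hM a b (Sum.inl_injective h)
    · cases h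
    · cases h
    · exact hN a b (Sum.inr_injective h)
  range_union := by
    have key : ∀ {X Y X' Y' : Type} (f : X → X') (g : Y → Y'),
        Set.range (Sum.map f g) = Sum.inl '' Set.range f ∪ Sum.inr '' Set.range g := by
      intro X Y X' Y' f g
      ext x
      cases x <;> simp
    rw [ModelWithCorners.boundary_disjointUnion, ← M.range_union, ← N.range_union,
      Set.image_union, Set.image_union, Set.union_union_union_comm]
    exact congrArg₂ (· ∪ ·) (key M.inMap N.inMap) (key M.outMap N.outMap)
  inMap_orientation := by
    rintro (a | a) v hv
    · have h := M.inMap_orientation a v hv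
      rw [← mfderiv_sumMap_inl M.inMap_smooth N.inMap_smooth a] at h
      exact h
    · have h := N.inMap_orientation a v hv
      rw [← mfderiv_sumMap_inr M.inMap_smooth N.inMap_smooth a] at h
      exact h
  outMap_orientation := by
    rintro (a | a) v hv
    · have h := M.outMap_orientation a v hv
      rw [← mfderiv_sumMap_inl M.outMap_smooth N.outMap_smooth a] at h
      exact h
    · have h := N.outMap_orientation a v hv
      rw [← mfderiv_sumMap_inr M.outMap_smooth N.outMap_smooth a] at h
      exact h

/-- Two cobordisms from `A` to `B` are equivalent if there is an orientation-preserving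
diffeomorphism between them that commutes with the boundary embeddings. -/
def Cobordism.Equivalent {d : ℕ} {A B : ClosedManifold d} (M N : Cobordism A B) : Prop :=
  ∃ ψ : M ≃ₘ^∞⟮halfSpaceModel d, halfSpaceModel d⟯ N,
    (∀ x : M, PreservesOrientation
      (mfderiv (halfSpaceModel d) (halfSpaceModel d) ψ x).toLinearMap
      (M.orientation x) (N.orientation (ψ x))) ∧
    (∀ a : A, ψ (M.inMap a) = N.inMap a) ∧ (∀ b : B, ψ (M.outMap b) = N.outMap b)

/-- The cobordism `P` is obtained by gluing `M` and `N` along `B`: it is the union of two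
smoothly embedded, orientation-preserving copies of `M` and `N` that meet exactly along `B`. -/
def Cobordism.IsGluing {d : ℕ} {A B C : ClosedManifold d} (M : Cobordism A B)
    (N : Cobordism B C) (P : Cobordism A C) : Prop :=
  ∃ (i : M → P) (j : N → P),
    ContMDiff (halfSpaceModel d) (halfSpaceModel d) ∞ i ∧
    ContMDiff (halfSpaceModel d) (halfSpaceModel d) ∞ j ∧
    Function.Injective i ∧ Function.Injective j ∧
    (∀ x : M, PreservesOrientation
      (mfderiv (halfSpaceModel d) (halfSpaceModel d) i x).toLinearMap
      (M.orientation x) (P.orientation (i x))) ∧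
    (∀ y : N, PreservesOrientation
      (mfderiv (halfSpaceModel d) (halfSpaceModel d) j y).toLinearMap
      (N.orientation y) (P.orientation (j y))) ∧
    Set.range i ∪ Set.range j = Set.univ ∧
    (∀ (x : M) (y : N), i x = j y ↔ ∃ b : B, x = M.outMap b ∧ y = N.inMap b) ∧
    (∀ a : A, i (M.inMap a) = P.inMap a) ∧ (∀ c : C, j (N.outMap c) = P.outMap c)

/-- The cobordism `M` is the mapping cylinder of the diffeomorphism `f : A → B`: it is a copy of
`A × [0, 1]`, with in-boundary `a ↦ (a, 0)` and out-boundary `f a ↦ (a, 1)`. For `f = id` this is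
the cylinder on `A`. (The boundary conditions of a cobordism force `f` to be an
orientation-preserving diffeomorphism and the orientation of `M` to be the product orientation.) -/
def Cobordism.IsMappingCylinder {d : ℕ} {A B : ClosedManifold d} (M : Cobordism A B)
    (f : A ≃ B) : Prop :=
  ∃ φ : (A × Set.Icc (0 : ℝ) 1) ≃ₘ^∞⟮halfSpaceModel d, halfSpaceModel d⟯ M,
    (∀ a : A, φ (a, 0) = M.inMap a) ∧ (∀ a : A, φ (a, 1) = M.outMap (f a))

/-! ### Topological quantum field theories -/

section TQFT

/-- A `(d + 1)`-dimensional oriented TQFT over `k`, that is, a symmetric monoidal functor from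
`(d + 1)`-dimensional cobordisms to vector spaces: `V A` is the vector space of `A`, `Z M` is the
linear map of the cobordism `M`, and `ε` and `μ` are the identifications `k = V ∅` and
`V A ⊗ V B = V (A ⊔ B)`. -/
structure IsTQFT (k : Type*) [Field k] {d : ℕ} (V : ClosedManifold d → Type*)
    [∀ A, AddCommGroup (V A)] [∀ A, Module k (V A)]
    (ε : k ≃ₗ[k] V (ClosedManifold.empty d))
    (μ : ∀ A B : ClosedManifold d, V A ⊗[k] V B ≃ₗ[k] V (A.sum B))
    (Z : ∀ {A B : ClosedManifold d}, Cobordism A B → (V A →ₗ[k] V B)) : Prop where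
  /-- Equivalent cobordisms have the same image. -/
  map_equivalent : ∀ {A B : ClosedManifold d} (M N : Cobordism A B), M.Equivalent N → Z M = Z N
  /-- Gluing goes to composition. -/
  map_gluing : ∀ {A B C : ClosedManifold d} (M : Cobordism A B) (N : Cobordism B C)
    (P : Cobordism A C), M.IsGluing N P → Z P = Z N ∘ₗ Z M
  /-- Cylinders go to identity maps. -/
  map_cylinder : ∀ {A : ClosedManifold d} (M : Cobordism A A),
    M.IsMappingCylinder (Equiv.refl A) → Z M = LinearMap.id
  /-- Disjoint unions of cobordisms go to tensor products. -/
  map_sum : ∀ {A B A' B' : ClosedManifold d} (M : Cobordism A B) (N : Cobordism A' B'),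
    Z (M.sum N) ∘ₗ (μ A A').toLinearMap = (μ B B').toLinearMap ∘ₗ TensorProduct.map (Z M) (Z N)
  /-- Compatibility with the associativity of disjoint unions. -/
  map_assoc : ∀ {A B C : ClosedManifold d}
    (M : Cobordism ((A.sum B).sum C) (A.sum (B.sum C))),
    M.IsMappingCylinder (Equiv.sumAssoc A B C) → ∀ (x : V A) (y : V B) (z : V C),
      Z M (μ (A.sum B) C (μ A B (x ⊗ₜ y) ⊗ₜ z)) = μ A (B.sum C) (x ⊗ₜ μ B C (y ⊗ₜ z))
  /-- Compatibility with the unit on the left. -/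
  map_empty_sum : ∀ {A : ClosedManifold d} (M : Cobordism ((ClosedManifold.empty d).sum A) A),
    M.IsMappingCylinder (Equiv.emptySum Empty A) → ∀ (c : k) (x : V A),
      Z M (μ (ClosedManifold.empty d) A (ε c ⊗ₜ x)) = c • x
  /-- Compatibility with the unit on the right. -/
  map_sum_empty : ∀ {A : ClosedManifold d} (M : Cobordism (A.sum (ClosedManifold.empty d)) A),
    M.IsMappingCylinder (Equiv.sumEmpty A Empty) → ∀ (c : k) (x : V A),
      Z M (μ A (ClosedManifold.empty d) (x ⊗ₜ ε c)) = c • x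
  /-- Compatibility with the symmetry. -/
  map_symm : ∀ {A B : ClosedManifold d} (M : Cobordism (A.sum B) (B.sum A)),
    M.IsMappingCylinder (Equiv.sumComm A B) → ∀ (x : V A) (y : V B),
      Z M (μ A B (x ⊗ₜ y)) = μ B A (y ⊗ₜ x)

/-- A `(d + 1)`-dimensional oriented TQFT over `k` whose vector spaces are all equal to the ground
field `k`, with the canonical identification `k ⊗ k = k`. Two of them are equal if they assign the
same linear maps `k → k` to all cobordisms. -/
@[ext]
structure LineTQFT (k : Type*) [Field k] (d : ℕ) where
  map : ∀ {A B : ClosedManifold d}, Cobordism A B → (k →ₗ[k] k)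
  isTQFT : IsTQFT k (fun _ : ClosedManifold d => k) (LinearEquiv.refl k k)
    (fun _ _ => TensorProduct.lid k k) map

namespace LineTQFT

variable {k : Type*} [Field k] {d : ℕ}

theorem end_apply (f : k →ₗ[k] k) (x : k) : f x = x * f 1 := by
  rw [← smul_eq_mul, ← map_smul, smul_eq_mul, mul_one]

theorem end_comp_comm (f g : k →ₗ[k] k) : f ∘ₗ g = g ∘ₗ f := by
  ext
  simp only [LinearMap.comp_apply]
  rw [end_apply f, end_apply g (f 1), mul_comm]

/-- The trivial TQFT: every cobordism goes to the identity of `k`. -/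
def trivial (k : Type*) [Field k] (d : ℕ) : LineTQFT k d where
  map _ := LinearMap.id
  isTQFT :=
    { map_equivalent := fun _ _ _ => rfl
      map_gluing := fun _ _ _ _ => rfl
      map_cylinder := fun _ _ => rfl
      map_sum := fun _ _ => by simp
      map_assoc := fun _ _ x y z => by simp [mul_assoc]
      map_empty_sum := fun _ _ c x => by simp
      map_sum_empty := fun _ _ c x => by simp [mul_comm]
      map_symm := fun _ _ x y => by simp [mul_comm] }

/-- The tensor product `f ⊗ g : k ⊗ k → k ⊗ k`, where `k ⊗ k = k`. -/
def tensorEnd (f g : k →ₗ[k] k) : k →ₗ[k] k :=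
  (TensorProduct.lid k k).toLinearMap ∘ₗ TensorProduct.map f g ∘ₗ
    (TensorProduct.lid k k).symm.toLinearMap

theorem tensorEnd_eq_comp (f g : k →ₗ[k] k) : tensorEnd f g = f ∘ₗ g := by
  ext
  rw [LinearMap.comp_apply, end_apply f (g 1)]
  simp [tensorEnd, mul_comm]

/-- The product of TQFTs: the tensor product of vector spaces and linear maps. -/
def tensor (S T : LineTQFT k d) : LineTQFT k d where
  map M := tensorEnd (S.map M) (T.map M)
  isTQFT :=
    { map_equivalent := fun M N h => by
        rw [S.isTQFT.map_equivalent M N h, T.isTQFT.map_equivalent M N h]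
      map_gluing := fun M N P h => by
        simp only [tensorEnd_eq_comp]
        rw [S.isTQFT.map_gluing M N P h, T.isTQFT.map_gluing M N P h]
        simp only [LinearMap.comp_assoc]
        rw [← LinearMap.comp_assoc (T.map M), end_comp_comm (S.map M) (T.map N)]
        simp only [LinearMap.comp_assoc]
      map_cylinder := fun M h => by
        rw [tensorEnd_eq_comp, S.isTQFT.map_cylinder M h, T.isTQFT.map_cylinder M h]
        rfl
      map_sum := fun M N => by
        simp only [tensorEnd_eq_comp]
        rw [LinearMap.comp_assoc, T.isTQFT.map_sum M N, ← LinearMap.comp_assoc,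
          S.isTQFT.map_sum M N, LinearMap.comp_assoc, ← TensorProduct.map_comp]
      map_assoc := fun M h x y z => by
        have h1 := S.isTQFT.map_assoc M h x y z
        have h2 := T.isTQFT.map_assoc M h x y z
        rw [tensorEnd_eq_comp, LinearMap.comp_apply, h2]
        simpa [mul_assoc] using h1
      map_empty_sum := fun M h c x => by
        have h1 := S.isTQFT.map_empty_sum M h c x
        have h2 := T.isTQFT.map_empty_sum M h c x
        rw [tensorEnd_eq_comp, LinearMap.comp_apply, h2]
        simpa [mul_assoc, mul_comm] using h1
      map_sum_empty := fun M h c x => by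
        have h1 := S.isTQFT.map_sum_empty M h c x
        have h2 := T.isTQFT.map_sum_empty M h c x
        rw [tensorEnd_eq_comp, LinearMap.comp_apply, h2]
        simpa [mul_assoc, mul_comm] using h1
      map_symm := fun M h x y => by
        have h1 := S.isTQFT.map_symm M h x y
        have h2 := T.isTQFT.map_symm M h x y
        rw [tensorEnd_eq_comp, LinearMap.comp_apply, h2]
        simpa [mul_assoc, mul_comm] using h1 }

instance : CommMonoid (LineTQFT k d) where
  mul := tensor
  one := trivial k d
  mul_assoc R S T := by
    refine LineTQFT.ext ?_
    funext A B M
    change tensorEnd (tensorEnd _ _) _ = tensorEnd _ (tensorEnd _ _)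
    simp only [tensorEnd_eq_comp, LinearMap.comp_assoc]
  one_mul T := by
    refine LineTQFT.ext ?_
    funext A B M
    exact tensorEnd_eq_comp _ _
  mul_one T := by
    refine LineTQFT.ext ?_
    funext A B M
    exact tensorEnd_eq_comp _ _
  mul_comm S T := by
    refine LineTQFT.ext ?_
    funext A B M
    change tensorEnd _ _ = tensorEnd _ _
    rw [tensorEnd_eq_comp, tensorEnd_eq_comp, end_comp_comm]

theorem mul_map (S T : LineTQFT k d) {A B : ClosedManifold d} (M : Cobordism A B) :
    (S * T).map M = S.map M ∘ₗ T.map M :=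
  tensorEnd_eq_comp _ _

theorem one_map {A B : ClosedManifold d} (M : Cobordism A B) :
    (1 : LineTQFT k d).map M = LinearMap.id := rfl

end LineTQFT

/-- The group of invertible TQFTs: those `T` for which there is a `T'` such that `T ⊗ T'` is the
trivial TQFT. -/
abbrev InvertibleTQFT (k : Type*) [Field k] (d : ℕ) : Type _ := (LineTQFT k d)ˣ

/-- The subgroup of the invertible TQFTs that send every cobordism with empty boundary to the
identity of `k`. -/
def trivialOnClosed (k : Type*) [Field k] (d : ℕ) : Subgroup (InvertibleTQFT k d) where
  carrier := {T | ∀ (A B : ClosedManifold d) (M : Cobordism A B),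
    (halfSpaceModel d).boundary M = ∅ → (T : LineTQFT k d).map M = LinearMap.id}
  one_mem' := fun _ _ _ _ => rfl
  mul_mem' := fun {S T} hS hT A B M hM => by
    rw [Units.val_mul, LineTQFT.mul_map, hS A B M hM, hT A B M hM]
    rfl
  inv_mem' := fun {T} hT A B M hM => by
    have h := LineTQFT.mul_map (T : LineTQFT k d) ((T⁻¹ : InvertibleTQFT k d) : LineTQFT k d) M
    rw [Units.mul_inv, LineTQFT.one_map, hT A B M hM] at h
    exact h.symm

end TQFT

end

/-! An invertible TQFT sends every cobordism to a nonzero scalar, so if `kˣ` is trivial there is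
only the trivial TQFT. Conversely, let `f` be a `kˣ`-valued function of closed manifolds that turns
disjoint unions into products and is `1` on empty manifolds. Then `M : A ⇝ B ↦ f(B) / f(A)` is an
invertible TQFT (`coboundary`), and it is trivial on cobordisms with empty boundary, since `A` and
`B` are then empty. If the subgroup is trivial, `f` therefore takes equal values at the two ends of
every cobordism (`eq_of_trivialOnClosed_eq_bot`). Apply this to the disc `∅ ⇝ S^d`, where `d = n -
1`. For a unit `u` and `d ≥ 1`, take `f = u ^ (number of components)`; the sphere is connected, so
`u = 1`. For `d = 0` the sphere has two components, and this would only give `u ^ 2 = 1`; but its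
two points have opposite signs, so `f = u ^ (number of positive points)` gives `u = 1`. Most of the
work is to make the closed disc an oriented cobordism: a smooth structure with boundary, from charts
given by smooth maps of the ambient spaces (`AmbientChart`), orientations by pulled back volume
forms (`isContinuousOrientation_of_forms`), and the boundary orientation (`induces_sphereToDisc`).
-/

noncomputable section

/-! ### TQFTs from multiplicative functions of closed manifolds. -/

namespace LineTQFT

variable {k : Type*} [Field k] {d : ℕ}

/-- The TQFT `M ↦ f(B) / f(A)`, for `M : A ⇝ B`, of a multiplicative function `f` of closed
manifolds. -/
def coboundary (f : ClosedManifold d → kˣ) (h0 : f (ClosedManifold.empty d) = 1)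
    (hs : ∀ A B : ClosedManifold d, f (A.sum B) = f A * f B) : LineTQFT k d where
  map {A B} _ := ((f B / f A : kˣ) : k) • LinearMap.id
  isTQFT :=
    { map_equivalent := fun _ _ _ => rfl
      map_gluing := fun {A B C} _ _ _ _ => by
        ext
        simp only [LinearMap.smul_apply, LinearMap.comp_apply, LinearMap.id_apply, smul_smul,
          ← Units.val_mul, div_mul_div_cancel]
      map_cylinder := fun _ _ => by simp
      map_sum := fun {A B A' B'} _ _ => by
        ext
        simp [hs, mul_div_mul_comm]
      -- The two ends of each structural cylinder are unions of the same pieces up to empty ones, so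
      -- `f` agrees on them and the scalar is `1`.
      map_assoc := fun _ _ x y z => by simp [hs, mul_assoc]
      map_empty_sum := fun _ _ c x => by simp [hs, h0]
      map_sum_empty := fun _ _ c x => by simp [hs, h0, mul_comm]
      map_symm := fun {A B} _ _ x y => by simp [hs, mul_comm] }

/-- `coboundary f` as an invertible TQFT. -/
def coboundaryUnit (f : ClosedManifold d → kˣ) (h0 : f (ClosedManifold.empty d) = 1)
    (hs : ∀ A B : ClosedManifold d, f (A.sum B) = f A * f B) : InvertibleTQFT k d where
  val := coboundary f h0 hs
  inv := coboundary (fun A => (f A)⁻¹) (by simp [h0]) (fun A B => by simp [hs, mul_comm])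
  val_inv := by
    refine LineTQFT.ext ?_
    funext A B M
    rw [mul_map, one_map]
    ext
    simp [coboundary]
    field_simp
  inv_val := by
    refine LineTQFT.ext ?_
    funext A B M
    rw [mul_map, one_map]
    ext
    simp [coboundary]
    field_simp

/-- The coboundary of `f` lies in the subgroup, hence is trivial, and its value on `M` is `f B / f
A`. The normalization is required for all manifolds with empty carrier because those are what a
cobordism with empty boundary has at its ends. -/
theorem eq_of_trivialOnClosed_eq_bot (h : trivialOnClosed k d = ⊥) (f : ClosedManifold d → kˣ)
    (h0 : ∀ A : ClosedManifold d, IsEmpty A → f A = 1)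
    (hs : ∀ A B : ClosedManifold d, f (A.sum B) = f A * f B) {A B : ClosedManifold d}
    (M : Cobordism A B) : f A = f B := by
  have h0' : f (ClosedManifold.empty d) = 1 := h0 _ (inferInstanceAs (IsEmpty Empty))
  have hmem : coboundaryUnit f h0' hs ∈ trivialOnClosed k d := by
    intro A B M hM
    have hr := M.range_union
    rw [hM, Set.union_empty_iff, Set.range_eq_empty_iff, Set.range_eq_empty_iff] at hr
    simp [coboundaryUnit, coboundary, h0 A hr.1, h0 B hr.2]
  rw [h, Subgroup.mem_bot] at hmem
  have h1 : (coboundary f h0' hs).map M = LinearMap.id :=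
    congrArg (fun T : InvertibleTQFT k d => (T : LineTQFT k d).map M) hmem
  have h2 := LinearMap.congr_fun h1 1
  simp only [coboundary, LinearMap.smul_apply, LinearMap.id_apply, smul_eq_mul, mul_one] at h2
  exact (div_eq_one.1 (Units.val_eq_one.1 h2)).symm

/-- The scalars of `T` and `T⁻¹` on a cobordism multiply to `1`, so each is a unit of `k`. -/
theorem trivialOnClosed_eq_bot_of_subsingleton [Subsingleton kˣ] : trivialOnClosed k d = ⊥ := by
  refine (Subgroup.eq_bot_iff_forall _).2 fun T _ => Units.ext (LineTQFT.ext ?_)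
  funext A B M
  have h := mul_map (T : LineTQFT k d) ((T⁻¹ : InvertibleTQFT k d) : LineTQFT k d) M
  rw [Units.mul_inv, one_map] at h
  have h1 := LinearMap.congr_fun h 1
  rw [LinearMap.id_apply, LinearMap.comp_apply, end_apply] at h1
  have h2 : (T : LineTQFT k d).map M 1 = 1 :=
    congrArg Units.val (Subsingleton.elim (Units.mk _ _ ((mul_comm _ _).trans h1.symm) h1.symm) 1)
  ext
  exact h2

end LineTQFT

/-! ### Additive counting invariants of closed manifolds. -/

section Components

/-- The components of a disjoint union. -/
def connectedComponentsSum (X Y : Type*) [TopologicalSpace X] [TopologicalSpace Y] :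
    ConnectedComponents (X ⊕ Y) ≃ ConnectedComponents X ⊕ ConnectedComponents Y where
  toFun := (continuous_sumMap.2 ⟨ConnectedComponents.continuous_coe,
    ConnectedComponents.continuous_coe⟩).connectedComponentsLift
  invFun := Sum.elim continuous_inl.connectedComponentsMap continuous_inr.connectedComponentsMap
  left_inv x := by
    obtain ⟨x | x, rfl⟩ := ConnectedComponents.surjective_coe x <;> rfl
  right_inv x := by
    rcases x with x | x <;> obtain ⟨x, rfl⟩ := ConnectedComponents.surjective_coe x <;> rfl

variable {d : ℕ}

/-- Components of a compact locally connected space are open, hence finite in number. Finiteness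
matters because `Nat.card` is `0` on infinite types and would not be additive. -/
instance (A : ClosedManifold d) : Finite (ConnectedComponents A) :=
  have : LocallyConnectedSpace A :=
    ChartedSpace.locallyConnectedSpace (EuclideanSpace ℝ (Fin d)) A
  inferInstance

theorem card_connectedComponents_sum (A B : ClosedManifold d) :
    Nat.card (ConnectedComponents (A.sum B)) =
      Nat.card (ConnectedComponents A) + Nat.card (ConnectedComponents B) :=
  (Nat.card_congr (connectedComponentsSum A B)).trans Nat.card_sum

instance (A : ClosedManifold 0) : Finite A :=
  have : DiscreteTopology A := ChartedSpace.discreteTopology (EuclideanSpace ℝ (Fin 0)) A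
  finite_of_compact_of_discrete

/-- A point of an oriented `0`-manifold is positive if its orientation is the ray of `1`. -/
def ClosedManifold.IsPositive (A : ClosedManifold 0) (x : A) : Prop :=
  ∃ (η : TangentSpace (𝓡 0) x [⋀^Fin 0]→ₗ[ℝ] ℝ) (hη : η ≠ 0),
    A.orientation x = rayOfNeZero ℝ η hη ∧ 0 < η 0

theorem card_isPositive_sum (A B : ClosedManifold 0) :
    Nat.card {x // (A.sum B).IsPositive x} =
      Nat.card {x // A.IsPositive x} + Nat.card {x // B.IsPositive x} :=
  (Nat.card_congr (Equiv.subtypeSum (p := (A.sum B).IsPositive))).trans Nat.card_sum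

end Components

/-! ### Continuous orientations from volume forms. -/

section Forms

variable {ι : Type*} [Fintype ι] [DecidableEq ι]

theorem AlternatingMap.apply_basis_ne_zero {F : Type*} [AddCommGroup F] [Module ℝ F]
    (b : Module.Basis ι ℝ F) {f : F [⋀^ι]→ₗ[ℝ] ℝ} (hf : f ≠ 0) : f b ≠ 0 := fun h =>
  hf (by rw [f.eq_smul_basis_det b, h, zero_smul])

/-- Top-degree forms are multiples of `b.det`, so equality of orientations becomes a sign condition
on numbers, which is open. -/
theorem AlternatingMap.sameRay_of_mul_pos {F : Type*} [AddCommGroup F] [Module ℝ F]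
    (b : Module.Basis ι ℝ F) {f g : F [⋀^ι]→ₗ[ℝ] ℝ} (h : 0 < f b * g b) : SameRay ℝ f g := by
  rw [f.eq_smul_basis_det b, g.eq_smul_basis_det b]
  rcases pos_and_pos_or_neg_and_neg_of_mul_pos h with ⟨hf, hg⟩ | ⟨hf, hg⟩
  · exact ((SameRay.refl b.det).pos_smul_left hf).pos_smul_right hg
  · rw [← neg_smul_neg _ b.det, ← neg_smul_neg _ b.det]
    exact ((SameRay.refl (-b.det)).pos_smul_left (neg_pos.2 hf)).pos_smul_right (neg_pos.2 hg)

theorem Module.Basis.continuous_det {W : Type*} [NormedAddCommGroup W] [NormedSpace ℝ W]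
    (b : Module.Basis ι ℝ W) : Continuous b.det := by
  have : FiniteDimensional ℝ W := b.finiteDimensional_of_finite
  change Continuous fun v => (b.toMatrix v).det
  refine Continuous.matrix_det (continuous_matrix fun i j => ?_)
  exact (LinearMap.continuous_of_finiteDimensional (b.coord i)).comp (continuous_apply j)

variable {F : Type*} [NormedAddCommGroup F] [NormedSpace ℝ F] {H : Type*} [TopologicalSpace H]
  {I : ModelWithCorners ℝ F H} {M : Type*} [TopologicalSpace M] [ChartedSpace H M]
  [IsManifold I ∞ M] {W : Type*} [NormedAddCommGroup W] [NormedSpace ℝ W]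

/-- Pulling back a continuous family of forms along a smooth map to a vector space gives a
continuous orientation if the pullbacks do not vanish. -/
theorem isContinuousOrientation_of_forms (b : Module.Basis ι ℝ F) {i : M → W}
    (hi : ContMDiff I 𝓘(ℝ, W) ∞ i) (w : M → W [⋀^ι]→ₗ[ℝ] ℝ)
    (hw : Continuous fun p : M × (ι → W) => w p.1 p.2)
    (hne : ∀ x, (w x).compLinearMap (mfderiv I 𝓘(ℝ, W) i x).toLinearMap ≠ 0) :
    IsContinuousOrientation I fun x => rayOfNeZero ℝ _ (hne x) := by
  have : IsManifold I 1 M := IsManifold.of_le (n := ∞) (by simp)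
  -- `B y` is the derivative of `i` at `y` read in the chart at `x`; unlike `D y` it depends
  -- continuously on `y` near `x`.
  intro x
  let D : M → F →L[ℝ] W := fun y => mfderiv I 𝓘(ℝ, W) i y
  set B : M → F →L[ℝ] W := inTangentCoordinates I 𝓘(ℝ, W) id i D x with hB
  have hBc : ContinuousAt B x :=
    ((hi x).mfderiv_const (m := 0) (by simp)).continuousAt
  have hBy : ∀ y ∈ (chartAt H x).source,
      B y = D y ∘L tangentCoordChange I x y y := by
    intro y hy
    rw [hB, inTangentCoordinates_eq id i D hy (mem_chart_source W (i y))]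
    ext v
    simp
  have hgc : ContinuousAt (fun y => w y (fun j => B y (b j))) x :=
    hw.continuousAt.comp (f := fun y => (y, fun j => B y (b j)))
      (continuousAt_id.prodMk (continuousAt_pi.2 fun j => hBc.clm_apply continuousAt_const))
  have hBx : B x = D x := by
    rw [hBy x (mem_chart_source H x)]
    ext v
    rw [ContinuousLinearMap.comp_apply, tangentCoordChange_self (mem_extChartAt_source x)]
  have hgx : w x (fun j => B x (b j)) ≠ 0 := by
    rw [hBx]
    exact AlternatingMap.apply_basis_ne_zero b (hne x)
  -- A continuous function that is nonzero at `x` keeps its sign near `x`.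
  have hpos : ∀ᶠ y in 𝓝 x, 0 < w y (fun j => B y (b j)) * w x (fun j => B x (b j)) :=
    (hgc.mul continuousAt_const).eventually (lt_mem_nhds (mul_self_pos.2 hgx))
  filter_upwards [hpos, (chartAt H x).open_source.mem_nhds (mem_chart_source H x)] with y hy hyx
  have hx' : y ∈ (extChartAt I x).source := by rwa [extChartAt_source]
  have hy' : y ∈ (extChartAt I y).source := mem_extChartAt_source y
  let e : F ≃ₗ[ℝ] F :=
    { (tangentCoordChange I y x y : F →L[ℝ] F).toLinearMap with
      invFun := tangentCoordChange I x y y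
      left_inv := fun v => by
        change tangentCoordChange I x y y (tangentCoordChange I y x y v) = v
        rw [tangentCoordChange_comp ⟨⟨hy', hx'⟩, hy'⟩, tangentCoordChange_self hy']
      right_inv := fun v => by
        change tangentCoordChange I y x y (tangentCoordChange I x y y v) = v
        rw [tangentCoordChange_comp ⟨⟨hx', hy'⟩, hx'⟩, tangentCoordChange_self hx'] }
  refine ⟨e, rfl, ?_⟩
  -- Transporting the form at `y` by `e` composes it with the inverse coordinate change; its value
  -- on `b` is then `w y` on the vectors `B y (b j)`.
  refine (ray_eq_iff _ _).2 (AlternatingMap.sameRay_of_mul_pos b ?_)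
  rw [hBx, hBy y hyx] at hy
  exact hy

end Forms

/-! ### Manifolds with boundary inside a normed space. -/

section AmbientCharts

variable {E : Type*} [NormedAddCommGroup E] [NormedSpace ℝ E]
  {F : Type*} [NormedAddCommGroup F] [NormedSpace ℝ F] {H : Type*} [TopologicalSpace H]

/-- A chart of a subset `S` of a normed space that is given by maps `E → F` and `F → E` which are
smooth in the sense of the ambient spaces. -/
structure AmbientChart (I : ModelWithCorners ℝ F H) (S : Set E) where
  toFun : E → F
  invFun : F → E
  source : Set E
  target : Set F
  open_source : IsOpen source
  open_target : IsOpen target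
  map_source : ∀ x ∈ S ∩ source, toFun x ∈ target ∩ Set.range I
  map_target : ∀ y ∈ target ∩ Set.range I, invFun y ∈ S ∩ source
  left_inv : ∀ x ∈ S ∩ source, invFun (toFun x) = x
  right_inv : ∀ y ∈ target ∩ Set.range I, toFun (invFun y) = y
  smooth : ∀ x ∈ S ∩ source, ContDiffAt ℝ ∞ toFun x
  smooth_inv : ContDiffOn ℝ ∞ invFun (target ∩ Set.range I)

namespace AmbientChart

variable {I : ModelWithCorners ℝ F H} {S : Set E}

theorem target_mem_nhdsWithin (c : AmbientChart I S) {x : S} (hx : (x : E) ∈ c.source) :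
    c.target ∩ Set.range I ∈ 𝓝[Set.range I] (c.toFun x) :=
  Filter.inter_mem (mem_nhdsWithin_of_mem_nhds
    (c.open_target.mem_nhds (c.map_source x ⟨x.2, hx⟩).1)) self_mem_nhdsWithin

variable [Nonempty S]

open Classical in
/-- The underlying chart. -/
def toChart (c : AmbientChart I S) : OpenPartialHomeomorph S H where
  toFun x := I.symm (c.toFun x)
  -- The arbitrary value is never taken on the target, by `map_target`.
  invFun y := if h : c.invFun (I y) ∈ S then ⟨_, h⟩ else Classical.arbitrary S
  source := Subtype.val ⁻¹' c.source
  target := I ⁻¹' c.target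
  map_source' x hx := by
    have h := c.map_source x ⟨x.2, hx⟩
    rw [Set.mem_preimage, I.right_inv h.2]
    exact h.1
  map_target' y hy := by
    have h := c.map_target (I y) ⟨hy, y, rfl⟩
    rw [dif_pos h.1]
    exact h.2
  left_inv' x hx := by
    have h := c.map_source x ⟨x.2, hx⟩
    have h' := c.left_inv x ⟨x.2, hx⟩
    apply Subtype.ext
    simp only [I.right_inv h.2, h', Subtype.coe_prop, dif_pos]
  right_inv' y hy := by
    have h := c.map_target (I y) ⟨hy, y, rfl⟩
    simp only [dif_pos h.1, c.right_inv (I y) ⟨hy, y, rfl⟩, I.left_inv]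
  open_source := c.open_source.preimage continuous_subtype_val
  open_target := c.open_target.preimage I.continuous
  continuousOn_toFun := I.continuous_symm.comp_continuousOn fun x hx =>
    ((c.smooth x ⟨x.2, hx⟩).continuousAt.comp
      continuous_subtype_val.continuousAt).continuousWithinAt
  continuousOn_invFun := by
    rw [Topology.IsInducing.subtypeVal.continuousOn_iff]
    refine (c.smooth_inv.continuousOn.comp I.continuous.continuousOn
      fun y hy => ⟨hy, y, rfl⟩).congr fun y hy => ?_
    simp only [Function.comp_apply, dif_pos (c.map_target (I y) ⟨hy, y, rfl⟩).1]

variable (c : AmbientChart I S)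

theorem extend_apply {x : S} (hx : (x : E) ∈ c.source) :
    I (c.toChart x) = c.toFun x :=
  I.right_inv (c.map_source x ⟨x.2, hx⟩).2

theorem extend_symm_apply {y : F} (hy : y ∈ c.target ∩ Set.range I) :
    (c.toChart.symm (I.symm y) : E) = c.invFun y := by
  have h := (c.map_target y hy).1
  have : c.toChart.symm (I.symm y) = ⟨c.invFun y, h⟩ := by
    classical
    change (if h : c.invFun (I (I.symm y)) ∈ S then (⟨_, h⟩ : S) else Classical.arbitrary S) = _
    simp only [I.right_inv hy.2, dif_pos h]
  rw [this]

theorem symm_mem_target {y : F} (hy : y ∈ I.symm ⁻¹' c.toChart.target ∩ Set.range I) :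
    y ∈ c.target ∩ Set.range I := by
  refine ⟨?_, hy.2⟩
  have h : I (I.symm y) ∈ c.target := hy.1
  rwa [I.right_inv hy.2] at h

/-- The charted space structure given by a cover by charts. -/
abbrev chartedSpace (c : S → AmbientChart I S) (hc : ∀ x : S, (x : E) ∈ (c x).source) :
    ChartedSpace H S where
  atlas := Set.range fun x => (c x).toChart
  chartAt x := (c x).toChart
  mem_chart_source x := hc x
  chart_mem_atlas x := ⟨x, rfl⟩

variable (c : S → AmbientChart I S) (hc : ∀ x : S, (x : E) ∈ (c x).source)

/-- In the model space a transition map is `(c b).toFun ∘ (c a).invFun`, a composite of smooth maps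
through `E`. -/
theorem isManifold : letI := chartedSpace c hc; IsManifold I ∞ S := by
  let := chartedSpace c hc
  refine isManifold_of_contDiffOn I ∞ S ?_
  rintro _ _ ⟨a, rfl⟩ ⟨b, rfl⟩
  have hmem : ∀ y ∈ I.symm ⁻¹' ((c a).toChart.symm ≫ₕ (c b).toChart).source ∩ Set.range I,
      y ∈ (c a).target ∩ Set.range I ∧ (c a).invFun y ∈ S ∩ (c b).source := by
    rintro y ⟨hy, hyI⟩
    rw [Set.mem_preimage, OpenPartialHomeomorph.trans_source] at hy
    have h1 := (c a).symm_mem_target ⟨hy.1, hyI⟩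
    refine ⟨h1, ((c a).map_target y h1).1, ?_⟩
    rw [← (c a).extend_symm_apply h1]
    exact hy.2
  intro y hy
  obtain ⟨h1, h2⟩ := hmem y hy
  have h3 : ContDiffWithinAt ℝ ∞ ((c b).toFun ∘ (c a).invFun)
      (I.symm ⁻¹' ((c a).toChart.symm ≫ₕ (c b).toChart).source ∩ Set.range I) y :=
    ((c b).smooth _ h2).comp_contDiffWithinAt y
      (((c a).smooth_inv y h1).mono fun z hz => (hmem z hz).1)
  have heq : ∀ z ∈ I.symm ⁻¹' ((c a).toChart.symm ≫ₕ (c b).toChart).source ∩ Set.range I,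
      (I ∘ (c a).toChart.symm ≫ₕ (c b).toChart ∘ I.symm) z = ((c b).toFun ∘ (c a).invFun) z := by
    intro z hz
    obtain ⟨h1, h2⟩ := hmem z hz
    have h4 := (c a).extend_symm_apply h1
    simp only [Function.comp_apply, OpenPartialHomeomorph.coe_trans]
    rw [(c b).extend_apply (by rw [h4]; exact h2.2), h4]
  exact h3.congr heq (heq y hy)

theorem extChartAt_apply (x : S) : letI := chartedSpace c hc
    ∀ z : S, (z : E) ∈ (c x).source → extChartAt I x z = (c x).toFun z :=
  fun _ hz => (c x).extend_apply hz

theorem coe_extChartAt_symm (x : S) : letI := chartedSpace c hc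
    ∀ y ∈ (c x).target ∩ Set.range I, ((extChartAt I x).symm y : E) = (c x).invFun y :=
  fun _ hy => (c x).extend_symm_apply hy

theorem contMDiff_coe : letI := chartedSpace c hc
    ContMDiff I 𝓘(ℝ, E) ∞ (Subtype.val : S → E) := by
  let := chartedSpace c hc
  intro x
  refine contMDiffAt_iff.2 ⟨continuous_subtype_val.continuousAt, ?_⟩
  rw [extChartAt_apply c hc x x (hc x)]
  have h0 := (c x).map_source x ⟨x.2, hc x⟩
  have h := ((c x).smooth_inv _ h0).mono_of_mem_nhdsWithin ((c x).target_mem_nhdsWithin (hc x))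
  refine h.congr_of_eventuallyEq ?_ (coe_extChartAt_symm c hc x _ h0)
  filter_upwards [(c x).target_mem_nhdsWithin (hc x)] with y hy
  exact coe_extChartAt_symm c hc x y hy

/-- In the chart at `x` the inclusion `S → E` is `invFun`. This makes its derivative computable from
the formula for the chart. -/
theorem hasFDerivWithinAt_invFun (x : S) : letI := chartedSpace c hc
    HasFDerivWithinAt (c x).invFun (mfderiv I 𝓘(ℝ, E) (Subtype.val : S → E) x : F →L[ℝ] E)
      (Set.range I) ((c x).toFun x) := by
  let := chartedSpace c hc
  have h1 : MDifferentiableAt I 𝓘(ℝ, E) (Subtype.val : S → E) x :=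
    (contMDiff_coe c hc x).mdifferentiableAt (by simp)
  have h2 := h1.hasMFDerivAt.2
  rw [extChartAt_apply c hc x x (hc x)] at h2
  have h0 := (c x).map_source x ⟨x.2, hc x⟩
  refine h2.congr_of_eventuallyEq ?_ (coe_extChartAt_symm c hc x _ h0).symm
  filter_upwards [(c x).target_mem_nhdsWithin (hc x)] with y hy
  exact (coe_extChartAt_symm c hc x y hy).symm

/-- Differentiating `toFun ∘ invFun = id` shows that the derivative of `toFun` is a left inverse;
derivatives within `Set.range I` are unique, also at boundary points. -/
theorem injective_mfderiv_coe (x : S) : letI := chartedSpace c hc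
    Function.Injective (mfderiv I 𝓘(ℝ, E) (Subtype.val : S → E) x : F →L[ℝ] E) := by
  let := chartedSpace c hc
  have h0 := (c x).map_source x ⟨x.2, hc x⟩
  have h1 := hasFDerivWithinAt_invFun c hc x
  have h2 : HasFDerivAt (c x).toFun (fderiv ℝ (c x).toFun x) ((c x).invFun ((c x).toFun x)) := by
    rw [(c x).left_inv x ⟨x.2, hc x⟩]
    exact (((c x).smooth x ⟨x.2, hc x⟩).differentiableAt (by simp)).hasFDerivAt
  have h3 := h2.comp_hasFDerivWithinAt _ h1
  have h4 : HasFDerivWithinAt id (ContinuousLinearMap.id ℝ F) (Set.range I) ((c x).toFun x) :=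
    hasFDerivWithinAt_id _ _
  have h5 := h4.congr_of_eventuallyEq (f₁ := (c x).toFun ∘ (c x).invFun)
    (Filter.mem_of_superset ((c x).target_mem_nhdsWithin (hc x)) fun y hy => (c x).right_inv y hy)
    ((c x).right_inv _ h0)
  have h6 := (I.uniqueDiffOn _ h0.2).eq h3 h5
  exact Function.LeftInverse.injective (g := fderiv ℝ (c x).toFun x)
    fun v => congrArg (fun L : F →L[ℝ] F => L v) h6

variable {F' : Type*} [NormedAddCommGroup F'] [NormedSpace ℝ F'] {H' : Type*} [TopologicalSpace H']
  {J : ModelWithCorners ℝ F' H'} {N : Type*} [TopologicalSpace N] [ChartedSpace H' N]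

/-- In the chart at `f x` the map is the ambient smooth `toFun` after the composite `N → E`. -/
theorem contMDiff_of_coe_comp {f : N → S} (hf : ContMDiff J 𝓘(ℝ, E) ∞ fun x => (f x : E)) :
    letI := chartedSpace c hc
    ContMDiff J I ∞ f := by
  let := chartedSpace c hc
  have hfc : Continuous f := Topology.IsInducing.subtypeVal.continuous_iff.2 hf.continuous
  intro x
  refine (contMDiffAt_iff_target (I := J) (I' := I)).2 ⟨hfc.continuousAt, ?_⟩
  have h := ((c (f x)).smooth (f x) ⟨(f x).2, hc (f x)⟩).contMDiffAt.comp x (hf x)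
  refine h.congr_of_eventuallyEq ?_
  filter_upwards [((c (f x)).open_source.preimage hf.continuous).mem_nhds (hc (f x))] with y hy
  exact extChartAt_apply c hc (f x) (f y) hy

end AmbientChart

end AmbientCharts

/-! ### The smooth structure of the closed disc. -/

section Disc

variable {d : ℕ}

instance : Fact (Module.finrank ℝ (EuclideanSpace ℝ (Fin (d + 1))) = d + 1) :=
  ⟨finrank_euclideanSpace_fin⟩

theorem range_halfSpaceModel (d : ℕ) :
    Set.range (halfSpaceModel d) = {y | 0 ≤ y.2 0} := by
  rw [modelWithCorners_prod_coe, Set.range_prodMap, range_modelWithCornersEuclideanHalfSpace]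
  ext y
  simp

theorem frontier_range_halfSpaceModel (d : ℕ) :
    frontier (Set.range (halfSpaceModel d)) = {y | y.2 0 = 0} := by
  rw [modelWithCorners_prod_coe, Set.range_prodMap, modelWithCornersSelf_coe, Set.range_id,
    frontier_univ_prod_eq, frontier_range_modelWithCornersEuclideanHalfSpace]
  ext y
  simp [eq_comm]

/-- A linear isomorphism from the ambient space of the closed disc to that of the half-space. -/
def discLinear (d : ℕ) : EuclideanSpace ℝ (Fin (d + 1)) ≃L[ℝ]
    EuclideanSpace ℝ (Fin d) × EuclideanSpace ℝ (Fin 1) :=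
  ContinuousLinearEquiv.ofFinrankEq (by simp)

/-- A translation that moves the image of the disc under `discLinear` into the half-space. -/
def discShift (d : ℕ) : EuclideanSpace ℝ (Fin d) × EuclideanSpace ℝ (Fin 1) :=
  (0, EuclideanSpace.single 0 (‖(discLinear d : EuclideanSpace ℝ (Fin (d + 1)) →L[ℝ]
    EuclideanSpace ℝ (Fin d) × EuclideanSpace ℝ (Fin 1))‖ + 1))

/-- On the unit ball the last coordinate of `discLinear` is at least minus its operator norm, and
the shift adds that norm plus `1`. -/
theorem discLinear_add_discShift_pos {x : EuclideanSpace ℝ (Fin (d + 1))} (hx : ‖x‖ ≤ 1) :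
    0 < (discLinear d x + discShift d).2 0 := by
  have h1 : ‖(discLinear d x).2 0‖ ≤ ‖(discLinear d x).2‖ := PiLp.norm_apply_le _ _
  have h2 : ‖(discLinear d x).2‖ ≤ ‖discLinear d x‖ := norm_snd_le _
  have h3 := (discLinear d : EuclideanSpace ℝ (Fin (d + 1)) →L[ℝ]
    EuclideanSpace ℝ (Fin d) × EuclideanSpace ℝ (Fin 1)).unit_le_opNorm x hx
  have h4 := neg_abs_le ((discLinear d x).2 0)
  have h5 := h1.trans (h2.trans h3)
  rw [Real.norm_eq_abs] at h5
  simp only [Prod.snd_add, PiLp.add_apply, discShift, PiLp.single_apply, if_true]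
  linarith

/-- The chart of the interior of the closed disc: a linear isomorphism followed by a translation
into the half-space. -/
def discInteriorChart (d : ℕ) :
    AmbientChart (halfSpaceModel d)
      (Metric.closedBall (0 : EuclideanSpace ℝ (Fin (d + 1))) 1) where
  toFun x := discLinear d x + discShift d
  invFun y := (discLinear d).symm (y - discShift d)
  source := {x | ‖x‖ < 1}
  target := {y | ‖(discLinear d).symm (y - discShift d)‖ < 1}
  open_source := isOpen_lt continuous_norm continuous_const
  open_target := isOpen_lt (by fun_prop) continuous_const
  map_source x hx := by
    refine ⟨by simpa using hx.2, ?_⟩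
    rw [range_halfSpaceModel]
    exact (discLinear_add_discShift_pos hx.2.le).le
  map_target y hy := ⟨mem_closedBall_zero_iff.2 hy.1.le, hy.1⟩
  left_inv x _ := by simp
  right_inv y _ := by simp
  smooth x _ := ((discLinear d).contDiff.add contDiff_const).contDiffAt
  smooth_inv := ((discLinear d).symm.contDiff.comp (contDiff_id.sub contDiff_const)).contDiffOn

theorem contDiff_stereographic'_symm (v : Metric.sphere (0 : EuclideanSpace ℝ (Fin (d + 1))) 1) :
    ContDiff ℝ ∞ fun q => ((stereographic' d v).symm q : EuclideanSpace ℝ (Fin (d + 1))) := by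
  let U := (OrthonormalBasis.fromOrthogonalSpanSingleton (𝕜 := ℝ) d
    (ne_zero_of_mem_unit_sphere v)).repr
  exact (contDiff_stereoInvFunAux.comp (ℝ ∙ v.1)ᗮ.subtypeL.contDiff).comp U.symm.contDiff

/-- The ambient form of `stereographic'`. -/
def stereographicAmbient (v : Metric.sphere (0 : EuclideanSpace ℝ (Fin (d + 1))) 1)
    (x : EuclideanSpace ℝ (Fin (d + 1))) : EuclideanSpace ℝ (Fin d) :=
  (OrthonormalBasis.fromOrthogonalSpanSingleton (𝕜 := ℝ) d
    (ne_zero_of_mem_unit_sphere v)).repr (stereoToFun v.1 x)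

theorem stereographic'_apply (v x : Metric.sphere (0 : EuclideanSpace ℝ (Fin (d + 1))) 1) :
    stereographic' d v x = stereographicAmbient v x := rfl

theorem contDiffAt_stereographicAmbient
    (v : Metric.sphere (0 : EuclideanSpace ℝ (Fin (d + 1))) 1) {x : EuclideanSpace ℝ (Fin (d + 1))}
    (hx : inner ℝ v.1 x ≠ 1) : ContDiffAt ℝ ∞ (stereographicAmbient v) x := by
  refine (LinearIsometryEquiv.contDiff _).contDiffAt.comp x
    (contDiffOn_stereoToFun.contDiffAt (IsOpen.mem_nhds ?_ hx))
  exact isOpen_ne_fun (innerSL ℝ v.1).continuous continuous_const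

theorem inner_sphere_lt_one_iff (v s : Metric.sphere (0 : EuclideanSpace ℝ (Fin (d + 1))) 1) :
    inner ℝ v.1 s.1 < 1 ↔ s ≠ v := by
  rw [inner_lt_one_iff_real_of_norm_eq_one (by simp) (by simp), ne_comm, Ne, Ne, Subtype.ext_iff]

theorem norm_smul_stereographic'_symm
    (v : Metric.sphere (0 : EuclideanSpace ℝ (Fin (d + 1))) 1)
    (y : EuclideanSpace ℝ (Fin d) × EuclideanSpace ℝ (Fin 1)) (hy : y.2 0 < 1) :
    ‖(1 - y.2 0) • ((stereographic' d v).symm y.1 : EuclideanSpace ℝ (Fin (d + 1)))‖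
      = 1 - y.2 0 := by
  rw [norm_smul, norm_eq_of_mem_sphere, mul_one, Real.norm_of_nonneg (sub_nonneg.2 hy.le)]

/-- The chart of the closed disc near the boundary: stereographic projection of `x / ‖x‖`, and
`1 - ‖x‖`. -/
def discBoundaryChart (v : Metric.sphere (0 : EuclideanSpace ℝ (Fin (d + 1))) 1) :
    AmbientChart (halfSpaceModel d)
      (Metric.closedBall (0 : EuclideanSpace ℝ (Fin (d + 1))) 1) :=
  -- The source condition excludes `0` and the ray through the centre of projection `v`.
  have key : ∀ x : EuclideanSpace ℝ (Fin (d + 1)), inner ℝ v.1 x < ‖x‖ →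
      0 < ‖x‖ ∧ inner ℝ v.1 (‖x‖⁻¹ • x) < 1 := fun x hx => by
    have hx0 : 0 < ‖x‖ := by
      refine norm_pos_iff.2 ?_
      rintro rfl
      simp at hx
    refine ⟨hx0, ?_⟩
    rw [inner_smul_right, inv_mul_lt_iff₀ hx0, mul_one]
    exact hx
  { toFun := fun x => (stereographicAmbient v (‖x‖⁻¹ • x), EuclideanSpace.single 0 (1 - ‖x‖))
    invFun := fun y =>
      (1 - y.2 0) • ((stereographic' d v).symm y.1 : EuclideanSpace ℝ (Fin (d + 1)))
    source := {x | inner ℝ v.1 x < ‖x‖}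
    target := {y | y.2 0 < 1}
    open_source := isOpen_lt (by fun_prop) continuous_norm
    open_target := isOpen_lt (by fun_prop) continuous_const
    map_source := fun x hx => by
      rw [range_halfSpaceModel]
      have h1 := (key x hx.2).1
      have h2 := mem_closedBall_zero_iff.1 hx.1
      refine ⟨?_, ?_⟩ <;> simp [h1, h2]
    map_target := fun y hy => by
      rw [range_halfSpaceModel] at hy
      have h1 : y.2 0 < 1 := hy.1
      have h2 : 0 ≤ y.2 0 := hy.2
      refine ⟨?_, ?_⟩
      · rw [mem_closedBall_zero_iff, norm_smul_stereographic'_symm v y h1]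
        linarith
      · rw [Set.mem_ofPred_eq, norm_smul_stereographic'_symm v y h1, inner_smul_right]
        have h3 := (inner_sphere_lt_one_iff v ((stereographic' d v).symm y.1)).2 (by
          have := (stereographic' d v).map_target (x := y.1) (by simp)
          simpa using this)
        exact mul_lt_of_lt_one_right (by linarith) h3
    left_inv := fun x hx => by
      obtain ⟨h1, h2⟩ := key x hx.2
      let s : Metric.sphere (0 : EuclideanSpace ℝ (Fin (d + 1))) 1 :=
        ⟨‖x‖⁻¹ • x, by simp [norm_smul, h1.ne']⟩
      have h3 : s ∈ (stereographic' d v).source := by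
        simpa using (inner_sphere_lt_one_iff v s).1 h2
      have h4 := (stereographic' d v).left_inv h3
      rw [stereographic'_apply] at h4
      simp only [PiLp.single_apply, if_true, sub_sub_cancel]
      change ‖x‖ • (((stereographic' d v).symm (stereographicAmbient v s) :
        Metric.sphere (0 : EuclideanSpace ℝ (Fin (d + 1))) 1) : EuclideanSpace ℝ (Fin (d + 1))) = x
      rw [h4, smul_inv_smul₀ h1.ne']
    right_inv := fun y hy => by
      have h0 : 0 < 1 - y.2 0 := sub_pos.2 hy.1
      have h1 := (stereographic' d v).right_inv (x := y.1) (by simp)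
      rw [stereographic'_apply] at h1
      rw [norm_smul_stereographic'_symm v y hy.1, inv_smul_smul₀ h0.ne', h1, sub_sub_cancel]
      refine Prod.ext rfl ?_
      ext i
      simp [Subsingleton.elim i 0]
    smooth := fun x hx => by
      obtain ⟨h1, h2⟩ := key x hx.2
      have hn : ContDiffAt ℝ ∞ (fun x : EuclideanSpace ℝ (Fin (d + 1)) => ‖x‖) x :=
        contDiffAt_norm ℝ (norm_pos_iff.1 h1)
      refine ContDiffAt.prodMk ?_ ?_
      · exact (contDiffAt_stereographicAmbient v h2.ne).comp (f := fun x => ‖x‖⁻¹ • x) x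
          ((hn.fun_inv h1.ne').fun_smul contDiffAt_id)
      · have : (fun x : EuclideanSpace ℝ (Fin (d + 1)) =>
            (EuclideanSpace.single 0 (1 - ‖x‖) : EuclideanSpace ℝ (Fin 1))) =
            fun x => (1 - ‖x‖) • EuclideanSpace.single 0 (1 : ℝ) := by
          ext x i
          simp [Subsingleton.elim i 0]
        rw [this]
        exact (contDiffAt_const.sub hn).smul contDiffAt_const
    smooth_inv := by
      refine ContDiff.contDiffOn (ContDiff.fun_smul ?_ ?_)
      · exact contDiff_const.sub ((contDiff_piLp_apply (p := 2)).comp contDiff_snd)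
      · exact (contDiff_stereographic'_symm v).comp contDiff_fst }

/-- The chart at a point of the closed disc. -/
def discChart (x : Metric.closedBall (0 : EuclideanSpace ℝ (Fin (d + 1))) 1) :
    AmbientChart (halfSpaceModel d)
      (Metric.closedBall (0 : EuclideanSpace ℝ (Fin (d + 1))) 1) :=
  if h : ‖(x : EuclideanSpace ℝ (Fin (d + 1)))‖ < 1 then discInteriorChart d
  -- Projecting from the antipode of `x` keeps `x` itself in the source.
  else discBoundaryChart (-⟨x.1, mem_sphere_zero_iff_norm.2
    (le_antisymm (mem_closedBall_zero_iff.1 x.2) (not_lt.1 h))⟩)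

theorem mem_discChart_source (x : Metric.closedBall (0 : EuclideanSpace ℝ (Fin (d + 1))) 1) :
    (x : EuclideanSpace ℝ (Fin (d + 1))) ∈ (discChart x).source := by
  by_cases h : ‖(x : EuclideanSpace ℝ (Fin (d + 1)))‖ < 1
  · rw [discChart, dif_pos h]
    exact h
  · rw [discChart, dif_neg h]
    change inner ℝ (-x.1) x.1 < ‖x.1‖
    have : ‖x.1‖ = 1 := le_antisymm (mem_closedBall_zero_iff.1 x.2) (not_lt.1 h)
    rw [inner_neg_left, real_inner_self_eq_norm_sq, this]
    norm_num

instance : Nonempty (Metric.closedBall (0 : EuclideanSpace ℝ (Fin (d + 1))) 1) :=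
  ⟨⟨0, by simp⟩⟩

instance : ChartedSpace (ModelProd (EuclideanSpace ℝ (Fin d)) (EuclideanHalfSpace 1))
    (Metric.closedBall (0 : EuclideanSpace ℝ (Fin (d + 1))) 1) :=
  AmbientChart.chartedSpace discChart mem_discChart_source

instance : IsManifold (halfSpaceModel d) ∞
    (Metric.closedBall (0 : EuclideanSpace ℝ (Fin (d + 1))) 1) :=
  AmbientChart.isManifold discChart mem_discChart_source

/-- In the preferred chart at `x` the last coordinate is positive if `‖x‖ < 1`, and is `1 - ‖x‖`
otherwise. -/
theorem mem_boundary_disc_iff (x : Metric.closedBall (0 : EuclideanSpace ℝ (Fin (d + 1))) 1) :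
    x ∈ (halfSpaceModel d).boundary (Metric.closedBall (0 : EuclideanSpace ℝ (Fin (d + 1))) 1) ↔
      ‖(x : EuclideanSpace ℝ (Fin (d + 1)))‖ = 1 := by
  have hx := mem_closedBall_zero_iff.1 x.2
  change extChartAt (halfSpaceModel d) x x ∈ frontier _ ↔ _
  rw [AmbientChart.extChartAt_apply discChart mem_discChart_source x x (mem_discChart_source x),
    frontier_range_halfSpaceModel]
  by_cases h : ‖(x : EuclideanSpace ℝ (Fin (d + 1)))‖ < 1
  · rw [discChart, dif_pos h]
    exact iff_of_false (discLinear_add_discShift_pos hx).ne' h.ne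
  · rw [discChart, dif_neg h]
    simp [discBoundaryChart, sub_eq_zero, eq_comm (a := (1 : ℝ))]

end Disc

/-! ### The oriented disc as a cobordism from the empty manifold to the sphere. -/

section DiscCobordism

variable {d : ℕ}

/-- The standard volume form. -/
def volForm (d : ℕ) : EuclideanSpace ℝ (Fin (d + 1)) [⋀^Fin (d + 1)]→ₗ[ℝ] ℝ :=
  (EuclideanSpace.basisFun (Fin (d + 1)) ℝ).toBasis.det

theorem continuous_volForm (d : ℕ) : Continuous (volForm d) :=
  Module.Basis.continuous_det _

theorem volForm_ne_zero (d : ℕ) : volForm d ≠ 0 :=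
  Module.Basis.det_ne_zero _

/-- The inclusion of the unit sphere. -/
abbrev sphereCoe (d : ℕ) : Metric.sphere (0 : EuclideanSpace ℝ (Fin (d + 1))) 1 →
    EuclideanSpace ℝ (Fin (d + 1)) := Subtype.val

/-- The inclusion of the closed unit disc. -/
abbrev discCoe (d : ℕ) : Metric.closedBall (0 : EuclideanSpace ℝ (Fin (d + 1))) 1 →
    EuclideanSpace ℝ (Fin (d + 1)) := Subtype.val

/-- The derivative of the inclusion of the unit sphere. -/
def sphereDeriv (x : Metric.sphere (0 : EuclideanSpace ℝ (Fin (d + 1))) 1) :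
    EuclideanSpace ℝ (Fin d) →L[ℝ] EuclideanSpace ℝ (Fin (d + 1)) :=
  mfderiv (𝓡 d) 𝓘(ℝ, EuclideanSpace ℝ (Fin (d + 1))) (sphereCoe d) x

/-- The derivative of the inclusion of the closed unit disc. -/
def discDeriv (x : Metric.closedBall (0 : EuclideanSpace ℝ (Fin (d + 1))) 1) :
    EuclideanSpace ℝ (Fin d) × EuclideanSpace ℝ (Fin 1) →L[ℝ] EuclideanSpace ℝ (Fin (d + 1)) :=
  mfderiv (halfSpaceModel d) 𝓘(ℝ, EuclideanSpace ℝ (Fin (d + 1))) (discCoe d) x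

theorem contMDiff_discCoe : ContMDiff (halfSpaceModel d) 𝓘(ℝ, EuclideanSpace ℝ (Fin (d + 1))) ∞
    (discCoe d) :=
  AmbientChart.contMDiff_coe discChart mem_discChart_source

theorem injective_discDeriv (x : Metric.closedBall (0 : EuclideanSpace ℝ (Fin (d + 1))) 1) :
    Function.Injective (discDeriv x) :=
  AmbientChart.injective_mfderiv_coe discChart mem_discChart_source x

theorem injective_sphereDeriv (x : Metric.sphere (0 : EuclideanSpace ℝ (Fin (d + 1))) 1) :
    Function.Injective (sphereDeriv x) :=
  injective_mvfderiv_subtypeVal_sphere x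

theorem inner_sphereDeriv (x : Metric.sphere (0 : EuclideanSpace ℝ (Fin (d + 1))) 1)
    (u : EuclideanSpace ℝ (Fin d)) : inner ℝ x.1 (sphereDeriv x u) = 0 := by
  have h : sphereDeriv x u ∈ (ℝ ∙ x.1)ᗮ := by
    rw [← range_mvfderiv_subtypeVal (n := d) x]
    exact ⟨u, rfl⟩
  exact Submodule.mem_orthogonal_singleton_iff_inner_right.1 h

theorem volForm_comp_discDeriv_ne_zero
    (x : Metric.closedBall (0 : EuclideanSpace ℝ (Fin (d + 1))) 1) :
    (volForm d).compLinearMap (discDeriv x).toLinearMap ≠ 0 := by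
  let e := LinearMap.linearEquivOfInjective (discDeriv x).toLinearMap (injective_discDeriv x)
    (by simp)
  exact mt ((volForm d).compLinearEquiv_eq_zero_iff e).1 (volForm_ne_zero d)

/-- The normal `x` and the image of a basis of the tangent space, which is orthogonal to `x`, form a
basis of the ambient space. -/
theorem volForm_curryLeft_comp_sphereDeriv_ne_zero
    (x : Metric.sphere (0 : EuclideanSpace ℝ (Fin (d + 1))) 1) :
    ((volForm d).curryLeft x.1).compLinearMap (sphereDeriv x).toLinearMap ≠ 0 := by
  intro h
  let b := (EuclideanSpace.basisFun (Fin d) ℝ).toBasis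
  have hli : LinearIndependent ℝ (Fin.cons x.1 (sphereDeriv x ∘ b) :
      Fin (d + 1) → EuclideanSpace ℝ (Fin (d + 1))) := by
    refine linearIndependent_finCons.2 ⟨b.linearIndependent.map' (sphereDeriv x).toLinearMap
      (LinearMap.ker_eq_bot.2 (injective_sphereDeriv x)), fun hx => ?_⟩
    have hle : Submodule.span ℝ (Set.range (sphereDeriv x ∘ b)) ≤ (ℝ ∙ x.1)ᗮ := by
      refine Submodule.span_le.2 ?_
      rintro _ ⟨i, rfl⟩
      exact Submodule.mem_orthogonal_singleton_iff_inner_right.2 (inner_sphereDeriv x _)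
    have h1 := Submodule.mem_orthogonal_singleton_iff_inner_right.1 (hle hx)
    rw [real_inner_self_eq_norm_sq, norm_eq_of_mem_sphere] at h1
    norm_num at h1
  let B := basisOfLinearIndependentOfCardEqFinrank hli (by simp)
  refine AlternatingMap.apply_basis_ne_zero B (volForm_ne_zero d) ?_
  rw [coe_basisOfLinearIndependentOfCardEqFinrank]
  exact congrArg (fun f => f b) h

/-- The standard volume form vanishes on vectors tangent to the sphere. -/
theorem volForm_eq_zero_of_inner_eq_zero
    {x : EuclideanSpace ℝ (Fin (d + 1))} (hx : x ≠ 0)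
    (u : Fin (d + 1) → EuclideanSpace ℝ (Fin (d + 1))) (hu : ∀ i, inner ℝ x (u i) = 0) :
    volForm d u = 0 := by
  refine AlternatingMap.map_linearDependent _ _ fun hli => hx ?_
  have h1 := hli.span_eq_top_of_card_eq_finrank' (by simp)
  have h2 : Submodule.span ℝ (Set.range u) ≤ (ℝ ∙ x)ᗮ := by
    refine Submodule.span_le.2 ?_
    rintro _ ⟨i, rfl⟩
    exact Submodule.mem_orthogonal_singleton_iff_inner_right.2 (hu i)
  have h3 : x ∈ (ℝ ∙ x)ᗮ := h2 (h1 ▸ Submodule.mem_top)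
  exact inner_self_eq_zero.1 (Submodule.mem_orthogonal_singleton_iff_inner_right.1 h3)

instance : IsManifold (𝓡 d) ∞ (Metric.sphere (0 : EuclideanSpace ℝ (Fin (d + 1))) 1) :=
  IsManifold.of_le (n := ω) le_top

/-- The unit sphere, with the orientation for which the outward normal vector followed by a
positive basis is positive. -/
def unitSphere (d : ℕ) : ClosedManifold d where
  carrier := Metric.sphere (0 : EuclideanSpace ℝ (Fin (d + 1))) 1
  orientation x := rayOfNeZero ℝ _ (volForm_curryLeft_comp_sphereDeriv_ne_zero x)
  orientation_cont := by
    refine isContinuousOrientation_of_forms (EuclideanSpace.basisFun (Fin d) ℝ).toBasis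
      contMDiff_coe_sphere (fun x => (volForm d).curryLeft x.1) ?_
      volForm_curryLeft_comp_sphereDeriv_ne_zero
    exact (continuous_volForm d).comp
      ((continuous_subtype_val.comp continuous_fst).matrixVecCons continuous_snd)

/-- The inclusion of the sphere into the disc. -/
def sphereToDisc (d : ℕ) : Metric.sphere (0 : EuclideanSpace ℝ (Fin (d + 1))) 1 →
    Metric.closedBall (0 : EuclideanSpace ℝ (Fin (d + 1))) 1 :=
  Set.inclusion Metric.sphere_subset_closedBall

theorem contMDiff_sphereToDisc : ContMDiff (𝓡 d) (halfSpaceModel d) ∞ (sphereToDisc d) :=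
  AmbientChart.contMDiff_of_coe_comp discChart mem_discChart_source contMDiff_coe_sphere

theorem discDeriv_mfderiv_sphereToDisc
    (x : Metric.sphere (0 : EuclideanSpace ℝ (Fin (d + 1))) 1) (u : EuclideanSpace ℝ (Fin d)) :
    discDeriv (sphereToDisc d x) (mfderiv (𝓡 d) (halfSpaceModel d) (sphereToDisc d) x u)
      = sphereDeriv x u := by
  have h := mfderiv_comp_apply x (g := discCoe d) (f := sphereToDisc d)
    ((contMDiff_discCoe (sphereToDisc d x)).mdifferentiableAt (by simp))
    ((contMDiff_sphereToDisc x).mdifferentiableAt (by simp)) u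
  exact h.symm

/-- The normal component of a tangent vector at the boundary of the disc. -/
theorem inner_discDeriv_sphereToDisc (x : Metric.sphere (0 : EuclideanSpace ℝ (Fin (d + 1))) 1)
    (v : EuclideanSpace ℝ (Fin d) × EuclideanSpace ℝ (Fin 1)) :
    inner ℝ x.1 (discDeriv (sphereToDisc d x) v) = -v.2 0 := by
  set c := discChart (sphereToDisc d x) with hc
  have hx : ¬ ‖(sphereToDisc d x).1‖ < 1 := by
    change ¬ ‖x.1‖ < 1
    simp
  have hc' : c = discBoundaryChart (-x) := by
    rw [hc, discChart, dif_neg hx]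
    rfl
  have hsrc := mem_discChart_source (sphereToDisc d x)
  have hmem := c.map_source x ⟨(sphereToDisc d x).2, hsrc⟩
  have hinv : c.invFun (c.toFun x) = x := c.left_inv x ⟨(sphereToDisc d x).2, hsrc⟩
  have h1 : HasFDerivWithinAt c.invFun (discDeriv (sphereToDisc d x))
      (Set.range (halfSpaceModel d)) (c.toFun x) :=
    AmbientChart.hasFDerivWithinAt_invFun discChart mem_discChart_source (sphereToDisc d x)
  -- In the boundary chart the squared norm is `(1 - y.2 0) ^ 2`. Its two derivatives at a point
  -- with `y.2 0 = 0` are twice the inner product sought and `-2 * v.2 0`.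
  have h2 := h1.norm_sq
  rw [hinv] at h2
  have hnorm : ∀ y ∈ c.target ∩ Set.range (halfSpaceModel d),
      ‖c.invFun y‖ ^ 2 = (1 - y.2 0) ^ 2 := by
    intro y hy
    rw [hc'] at hy ⊢
    exact congrArg (· ^ 2) (norm_smul_stereographic'_symm _ y hy.1)
  have h0 : (c.toFun x).2 0 = 0 := by
    rw [hc']
    simp [discBoundaryChart]
  have h3 : HasFDerivAt (fun y : EuclideanSpace ℝ (Fin d) × EuclideanSpace ℝ (Fin 1) => y.2 0)
      ((EuclideanSpace.proj (𝕜 := ℝ) (0 : Fin 1)).comp (ContinuousLinearMap.snd ℝ _ _))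
      (c.toFun x) :=
    ((EuclideanSpace.proj (𝕜 := ℝ) (0 : Fin 1)).comp (ContinuousLinearMap.snd ℝ
      (EuclideanSpace ℝ (Fin d)) (EuclideanSpace ℝ (Fin 1)))).hasFDerivAt
  have h4 := ((h3.const_sub 1).pow 2).hasFDerivWithinAt (s := Set.range (halfSpaceModel d))
  have h5 := h2.congr_of_eventuallyEq (Filter.mem_of_superset (c.target_mem_nhdsWithin hsrc)
    fun y hy => (hnorm y hy).symm) (hnorm _ hmem).symm
  have h6 := (halfSpaceModel d).uniqueDiffOn _ hmem.2 |>.eq h5 h4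
  have h7 := congrArg (fun L : _ →L[ℝ] ℝ => L v) h6
  simp [h0] at h7
  linarith

/-- In the ambient space an outward vector `v` is `c • x` plus a vector tangent to the sphere, with
`c = -v.2 0 > 0`. The tangent part does not contribute to the contracted volume form on tangent
vectors, so contraction with `v` is `c` times contraction with the outward normal. -/
theorem induces_sphereToDisc (x : Metric.sphere (0 : EuclideanSpace ℝ (Fin (d + 1))) 1)
    (v : EuclideanSpace ℝ (Fin d) × EuclideanSpace ℝ (Fin 1)) (hv : v.2 0 < 0) :
    InducesOrientation (mfderiv (𝓡 d) (halfSpaceModel d) (sphereToDisc d) x).toLinearMap v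
      ((unitSphere d).orientation x)
      (rayOfNeZero ℝ _ (volForm_comp_discDeriv_ne_zero (sphereToDisc d x))) := by
  let c : ℝ := -v.2 0
  have hv' : 0 < c := neg_pos.2 hv
  have hx0 : x.1 ≠ 0 := ne_zero_of_mem_unit_sphere x
  let L : EuclideanSpace ℝ (Fin d) →L[ℝ] EuclideanSpace ℝ (Fin d) × EuclideanSpace ℝ (Fin 1) :=
    mfderiv (𝓡 d) (halfSpaceModel d) (sphereToDisc d) x
  have key : ((((volForm d).compLinearMap
      (discDeriv (sphereToDisc d x)).toLinearMap).curryLeft v).compLinearMap L.toLinearMap) =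
      c • ((volForm d).curryLeft x.1).compLinearMap (sphereDeriv x).toLinearMap := by
    ext u
    have h1 : volForm d (Matrix.vecCons (discDeriv (sphereToDisc d x) v - c • x.1)
        (fun i => sphereDeriv x (u i))) = 0 := by
      refine volForm_eq_zero_of_inner_eq_zero hx0 _ fun i => ?_
      refine Fin.cases ?_ (fun i => ?_) i
      · rw [Matrix.cons_val_zero, inner_sub_right, inner_discDeriv_sphereToDisc,
          inner_smul_right, real_inner_self_eq_norm_sq, norm_eq_of_mem_sphere]
        ring
      · exact inner_sphereDeriv x _
    have h2 : ((volForm d).curryLeft (discDeriv (sphereToDisc d x) v - c • x.1))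
        (fun i => sphereDeriv x (u i)) = 0 := h1
    rw [map_sub, map_smul, AlternatingMap.sub_apply, sub_eq_zero] at h2
    refine Eq.trans ?_ h2
    refine congrArg (volForm d) (funext fun i => ?_)
    refine Fin.cases rfl (fun i => ?_) i
    exact discDeriv_mfderiv_sphereToDisc x (u i)
  have hne : c • ((volForm d).curryLeft x.1).compLinearMap
      (sphereDeriv x).toLinearMap ≠ 0 :=
    smul_ne_zero hv'.ne' (volForm_curryLeft_comp_sphereDeriv_ne_zero x)
  refine ⟨_, volForm_comp_discDeriv_ne_zero (sphereToDisc d x), key ▸ hne, rfl, ?_⟩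
  have hray := (SameRay.refl (R := ℝ)
    (((volForm d).curryLeft x.1).compLinearMap (sphereDeriv x).toLinearMap)).pos_smul_right hv'
  rw [← key] at hray
  exact (ray_eq_iff _ _).2 hray

/-- The closed unit disc as a cobordism from the empty manifold to the sphere. -/
def unitDisc (d : ℕ) : Cobordism (ClosedManifold.empty d) (unitSphere d) where
  carrier := Metric.closedBall (0 : EuclideanSpace ℝ (Fin (d + 1))) 1
  orientation x := rayOfNeZero ℝ _ (volForm_comp_discDeriv_ne_zero x)
  orientation_cont := by
    refine isContinuousOrientation_of_forms
      (Module.finBasisOfFinrankEq ℝ (EuclideanSpace ℝ (Fin d) × EuclideanSpace ℝ (Fin 1)) (by simp))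
      contMDiff_discCoe (fun _ => volForm d) ?_ volForm_comp_discDeriv_ne_zero
    exact (continuous_volForm d).comp continuous_snd
  inMap := Empty.elim
  outMap := sphereToDisc d
  inMap_smooth := fun x => x.elim
  outMap_smooth := contMDiff_sphereToDisc
  inMap_injective := fun x => x.elim
  outMap_injective := Set.inclusion_injective Metric.sphere_subset_closedBall
  disjoint_range := Set.disjoint_range_iff.2 fun x => x.elim
  range_union := by
    ext x
    rw [mem_boundary_disc_iff]
    constructor
    · rintro (⟨y, _⟩ | ⟨y, rfl⟩)
      · exact y.elim
      · exact norm_eq_of_mem_sphere y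
    · exact fun hx => Or.inr ⟨⟨x.1, mem_sphere_zero_iff_norm.2 hx⟩, rfl⟩
  inMap_orientation := fun x => x.elim
  outMap_orientation := induces_sphereToDisc

end DiscCobordism

/-! ### The invariants of spheres, and the theorem. -/

theorem card_connectedComponents_unitSphere (d : ℕ) :
    Nat.card (ConnectedComponents (unitSphere (d + 1))) = 1 := by
  have h : IsConnected (Metric.sphere (0 : EuclideanSpace ℝ (Fin (d + 1 + 1))) 1) := by
    refine isConnected_sphere ?_ 0 zero_le_one
    rw [← Module.finrank_eq_rank, finrank_euclideanSpace_fin]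
    exact_mod_cast (by lia : 1 < d + 1 + 1)
  have : ConnectedSpace (unitSphere (d + 1)) := isConnected_iff_connectedSpace.1 h
  rw [Nat.card_eq_one_iff_unique]
  exact ⟨inferInstance, inferInstance⟩

theorem volForm_zero_apply (u : Fin 1 → EuclideanSpace ℝ (Fin 1)) : volForm 0 u = u 0 0 := by
  rw [volForm, Module.Basis.det_apply, Matrix.det_fin_one, Module.Basis.toMatrix_apply]
  simp

/-- For the sphere in the line, the contracted volume form is a `0`-form, the number `x.1 0`. -/
theorem isPositive_unitSphere_iff
    (x : Metric.sphere (0 : EuclideanSpace ℝ (Fin (0 + 1))) 1) :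
    (unitSphere 0).IsPositive x ↔ 0 < x.1 0 := by
  have hω : ((volForm 0).curryLeft x.1).compLinearMap (sphereDeriv x).toLinearMap 0 = x.1 0 :=
    volForm_zero_apply _
  constructor
  · rintro ⟨η, hη, h, hpos⟩
    obtain ⟨r, s, hr, hs, hrs⟩ := ((ray_eq_iff _ _).1 h).exists_pos
      (volForm_curryLeft_comp_sphereDeriv_ne_zero x) hη
    have h1 : r * (((volForm 0).curryLeft x.1).compLinearMap (sphereDeriv x).toLinearMap 0)
        = s * η (0 : Fin 0 → EuclideanSpace ℝ (Fin 0)) :=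
      DFunLike.congr_fun hrs (0 : Fin 0 → EuclideanSpace ℝ (Fin 0))
    rw [hω] at h1
    exact (mul_pos_iff_of_pos_left hr).1 (h1 ▸ mul_pos hs hpos)
  · exact fun h => ⟨_, volForm_curryLeft_comp_sphereDeriv_ne_zero x, rfl, hω ▸ h⟩

theorem card_isPositive_unitSphere : Nat.card {x // (unitSphere 0).IsPositive x} = 1 := by
  have key : ∀ x : Metric.sphere (0 : EuclideanSpace ℝ (Fin (0 + 1))) 1,
      0 < x.1 0 ↔ x.1 = EuclideanSpace.single 0 1 := by
    intro x
    have h1 := norm_eq_of_mem_sphere x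
    rw [EuclideanSpace.norm_eq, Real.sqrt_eq_one, Fin.sum_univ_one, Real.norm_eq_abs, sq_abs] at h1
    constructor
    · intro h
      ext i
      rw [Fin.fin_one_eq_zero i]
      simp only [PiLp.single_apply, if_true]
      nlinarith
    · intro h
      rw [h]
      simp
  rw [Nat.card_eq_one_iff_unique]
  refine ⟨⟨fun x y => Subtype.ext (Subtype.ext ?_)⟩,
    ⟨⟨⟨EuclideanSpace.single 0 1, by simp⟩, (isPositive_unitSphere_iff _).2 ((key _).2 rfl)⟩⟩⟩
  exact ((key x.1).1 ((isPositive_unitSphere_iff _).1 x.2)).trans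
    ((key y.1).1 ((isPositive_unitSphere_iff _).1 y.2)).symm

end

theorem mainTheorem3 (k : Type*) [Field k] (d : ℕ) :
    trivialOnClosed k d = ⊥ ↔ Subsingleton kˣ := by
  constructor
  · intro h
    suffices H : ∀ u : kˣ, u = 1 from ⟨fun u v => (H u).trans (H v).symm⟩
    intro u
    have hE : IsEmpty (ClosedManifold.empty d) := inferInstanceAs (IsEmpty Empty)
    -- The `0`-sphere is disconnected, so `d = 0` needs the count of positive points instead of
    -- components.
    cases d with
    | zero =>
      have h1 := LineTQFT.eq_of_trivialOnClosed_eq_bot h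
        (fun A => u ^ Nat.card {x // A.IsPositive x})
        (fun A hA => by simp) (fun A B => by rw [card_isPositive_sum, pow_add]) (unitDisc 0)
      simpa [card_isPositive_unitSphere] using h1.symm
    | succ d =>
      have h0 : ∀ A : ClosedManifold (d + 1), IsEmpty A →
          u ^ Nat.card (ConnectedComponents A) = 1 := fun A hA => by
        have := ConnectedComponents.surjective_coe (α := A).isEmpty
        rw [Nat.card_of_isEmpty, pow_zero]
      have h1 := LineTQFT.eq_of_trivialOnClosed_eq_bot h
        (fun A => u ^ Nat.card (ConnectedComponents A)) h0
        (fun A B => by rw [card_connectedComponents_sum, pow_add]) (unitDisc (d + 1))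
      simpa [card_connectedComponents_unitSphere, h0 _ hE] using h1.symm
  · exact fun _ => LineTQFT.trivialOnClosed_eq_bot_of_subsingleton
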